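/- \textbf{Setting.} For a biadditive map $\beta:A\times B\to C$ of abelian groups, let \[\mathrm{Adj}(\beta)=\{(X,Y)\in \mathrm{End}(A)\times \mathrm{End}(B)^{\mathrm{op}} : \beta(Xu,v)=\beta(u,Yv)\ \forall u,v\},\] \[\mathrm{Cent}(\beta)=\{(X,Y;Z)\in \mathrm{End}(A)\times \mathrm{End}(B)\times \mathrm{End}(C) : \beta(Xu,v)=Z\beta(u,v)=\beta(u,Yv)\ \forall u,v\},\] \[\mathrm{Der}(\beta)=\{(X,Y;Z)\in \mathfrak{gl}(A)\times \mathfrak{gl}(B)\times \mathfrak{gl}(C) : \beta(Xu,v)+\beta(u,Yv)=Z\beta(u,v)\ \forall u,v\}.\] The radical of $\mathrm{Adj}(\beta)$ and of $\mathrm{Cent}(\beta)$ is the Jacobson radical. The radical of $\mathrm{Der}(\beta)$ is the Jacobson radical of its associative enveloping ring, the subring of $\mathrm{End}(A)\times \mathrm{End}(B)\times \mathrm{End}(C)$ generated by $\mathrm{Der}(\beta)$. Each of the three associative rings (adjoint ring, centroid, enveloping ring) acts on $A$ through its first coordinate. A filter on a group $G$ is a map $\phi$ from $\mathbb N$ to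 the subgroups of $G$ with $\phi_0=G$ and $[\phi_s,\phi_t]\le\phi_{s+t}\le\phi_s\cap\phi_t$ for all $s,t$. Put $\phi_s^+=\langle \phi_{s+t}: t\neq 0\rangle$ and, for $s>0$, $L_s=\phi_s/\phi_s^+$, which is an abelian group. For $s,t>0$ commutation $[x,y]=x^{-1}y^{-1}xy$ induces a biadditive map $[,]:L_s\times L_t\to L_{s+t}$. Let $s$ be the least positive integer with $L_s\ne 0$, and let $J$ be the Jacobson radical of one of the three associative rings above for the bimap $[,]:L_s\times L_s\to L_{2s}$. Define $H_i$ by $\phi_s^+\le H_i\le \phi_s$ and $H_i/\phi_s^+=L_sJ^i$, and put $\alpha_u^i=\phi_u$ if $i=0$ or $u\neq s$, and $\alpha_s^i=H_i$. The lex-least adjoint (respectively centroid, derivation) refinement of $\phi$ is the map $\bar\alpha$ from $\mathbb N^2$ to the subgroups of $G$ given by \[\bar\alpha_x=\prod\,[\alpha_{x_1},\dots,\alpha_{x_d}],\] the subgroup generated by the left-normed commutators over all nonempty sequences $x_1,\dots,x_d$ in $\{(u,i)\in\mathbb N^2 : (u,i)<(s+1,0)\}$ with $x_1+\dots+x_d=x$,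 where $<$ is the lexicographic order with the first coordinate most significant. The refinement is proper if $\{\bar\alpha_x : x\in\mathbb N^2\}\neq\{\phi_s : s\in\mathbb N\}$. The $\gamma$ series of a group $F$ has $\gamma_i$ equal to the $i$-fold commutator $[F,\dots,F]$ for $i>0$, and is a filter either on $F$ with $\gamma_0=F$ or on the holomorph $\mathrm{Aut}(F)\ltimes F$ with $\gamma_0=\mathrm{Aut}(F)\ltimes F$. \textbf{Statement.} Let $F$ be a nonabelian free group of finite rank $r$ and let $[,]:\gamma_1/\gamma_2\times\gamma_1/\gamma_2\to\gamma_2/\gamma_3$ be its commutation bimap. (1) There are isomorphisms $f:\gamma_1/\gamma_2\to\mathbb Z^r$ and $g:\gamma_2/\gamma_3\to\Lambda^2\mathbb Z^r$ with $g([u,v])=f(u)\wedge f(v)$ for all $u,v$. (2) $\mathrm{Adj}([,])\cong\mathbb Z$ if $r\ne2$, $\mathrm{Adj}([,])\cong M_2(\mathbb Z)$ if $r=2$, and $\mathrm{Cent}([,])\cong\mathbb Z$, as rings. (3) The Jacobson radicals of $\mathrm{Adj}([,])$, of $\mathrm{Cent}([,])$ and of the associative enveloping ring of $\mathrm{Der}([,])$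 are zero. (4) For both choices of $\gamma_0$, the least positive $s$ with $L_s\neq 0$ is $s=1$, and none of the lex-least adjoint, centroid and derivation refinements of the $\gamma$ series is proper: each has exactly the same set of terms as the $\gamma$ series. -/

import Mathlib

/-! ## Rings of a bimap -/

namespace Bimap

variable {A B C : Type*} [AddCommGroup A] [AddCommGroup B] [AddCommGroup C]

/-- The adjoint ring of a biadditive map `β : A × B → C`: the pairs `(X, Y)` in
`End A × (End B)ᵒᵖ` with `β (X u) v = β u (Y v)`. (Endomorphisms are written on the left.) -/
def Adj (β : A →+ B →+ C) : Subring (AddMonoid.End A × (AddMonoid.End B)ᵐᵒᵖ) where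
  carrier := {p | ∀ u v, β (p.1 u) v = β u (p.2.unop v)}
  mul_mem' := fun {p q} hp hq u v => (hp (q.1 u) v).trans (hq u (p.2.unop v))
  one_mem' := fun _ _ => rfl
  add_mem' := fun {p q} hp hq u v => by
    change β (p.1 u + q.1 u) v = β u (p.2.unop v + q.2.unop v)
    rw [map_add, map_add, AddMonoidHom.add_apply, hp u v, hq u v]
  zero_mem' := fun u v => by
    change β 0 v = β u 0
    rw [map_zero, map_zero, AddMonoidHom.zero_apply]
  neg_mem' := fun {p} hp u v => by
    change β (-p.1 u) v = β u (-p.2.unop v)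
    rw [map_neg, map_neg, AddMonoidHom.neg_apply, hp u v]

/-- The centroid of a biadditive map `β : A × B → C`: the triples `(X, Y; Z)` with
`β (X u) v = Z (β u v) = β u (Y v)`. -/
def Cent (β : A →+ B →+ C) :
    Subring (AddMonoid.End A × AddMonoid.End B × AddMonoid.End C) where
  carrier := {p | ∀ u v, β (p.1 u) v = p.2.2 (β u v) ∧ β u (p.2.1 v) = p.2.2 (β u v)}
  mul_mem' := fun {p q} hp hq u v =>
    ⟨(hp (q.1 u) v).1.trans (congrArg p.2.2 (hq u v).1),
      (hp u (q.2.1 v)).2.trans (congrArg p.2.2 (hq u v).2)⟩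
  one_mem' := fun _ _ => ⟨rfl, rfl⟩
  add_mem' := fun {p q} hp hq u v => by
    change β (p.1 u + q.1 u) v = p.2.2 (β u v) + q.2.2 (β u v) ∧
      β u (p.2.1 v + q.2.1 v) = p.2.2 (β u v) + q.2.2 (β u v)
    rw [map_add, map_add, AddMonoidHom.add_apply, (hp u v).1, (hq u v).1, (hp u v).2, (hq u v).2]
    exact ⟨rfl, rfl⟩
  zero_mem' := fun u v => by
    change β 0 v = 0 ∧ β u 0 = 0
    rw [map_zero, map_zero]
    exact ⟨rfl, rfl⟩
  neg_mem' := fun {p} hp u v => by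
    change β (-p.1 u) v = -p.2.2 (β u v) ∧ β u (-p.2.1 v) = -p.2.2 (β u v)
    rw [map_neg, map_neg, AddMonoidHom.neg_apply, (hp u v).1, (hp u v).2]
    exact ⟨rfl, rfl⟩

/-- The derivation algebra of a biadditive map `β : A × B → C`: the triples `(X, Y; Z)` with
`β (X u) v + β u (Y v) = Z (β u v)`. It is a Lie ring under `p q - q p`, see `der_lie_mem`. -/
def Der (β : A →+ B →+ C) :
    AddSubgroup (AddMonoid.End A × AddMonoid.End B × AddMonoid.End C) where
  carrier := {p | ∀ u v, β (p.1 u) v + β u (p.2.1 v) = p.2.2 (β u v)}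
  add_mem' := fun {p q} hp hq u v => by
    change β (p.1 u + q.1 u) v + β u (p.2.1 v + q.2.1 v) = p.2.2 (β u v) + q.2.2 (β u v)
    rw [map_add, map_add, AddMonoidHom.add_apply, ← hp u v, ← hq u v]
    abel
  zero_mem' := fun u v => by
    change β 0 v + β u 0 = 0
    rw [map_zero, map_zero, AddMonoidHom.zero_apply, add_zero]
  neg_mem' := fun {p} hp u v => by
    change β (-p.1 u) v + β u (-p.2.1 v) = -p.2.2 (β u v)
    rw [map_neg, map_neg, AddMonoidHom.neg_apply, ← hp u v]
    abel

theorem der_lie_mem (β : A →+ B →+ C) {p q : AddMonoid.End A × AddMonoid.End B × AddMonoid.End C}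
    (hp : p ∈ Der β) (hq : q ∈ Der β) : p * q - q * p ∈ Der β := by
  intro u v
  have hp' : ∀ u v, β (p.1 u) v + β u (p.2.1 v) = p.2.2 (β u v) := hp
  have hq' : ∀ u v, β (q.1 u) v + β u (q.2.1 v) = q.2.2 (β u v) := hq
  change β (p.1 (q.1 u) - q.1 (p.1 u)) v + β u (p.2.1 (q.2.1 v) - q.2.1 (p.2.1 v))
    = p.2.2 (q.2.2 (β u v)) - q.2.2 (p.2.2 (β u v))
  rw [← hp' u v, ← hq' u v, map_add, map_add, ← hp', ← hp', ← hq', ← hq', map_sub, map_sub,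
    AddMonoidHom.sub_apply]
  abel

/-- The associative enveloping algebra of the derivation algebra: the subring generated by the
derivations. Its Jacobson radical is what is meant by the radical of the derivation algebra. -/
def DerEnv (β : A →+ B →+ C) :
    Subring (AddMonoid.End A × AddMonoid.End B × AddMonoid.End C) :=
  Subring.closure (Der β : Set (AddMonoid.End A × AddMonoid.End B × AddMonoid.End C))

/-- The action of the adjoint ring on the first variable. -/
def adjAct (β : A →+ B →+ C) : Adj β →+* AddMonoid.End A :=
  (RingHom.fst _ _).comp (Adj β).subtype

/-- The action of the centroid on the first variable. -/
def centAct (β : A →+ B →+ C) : Cent β →+* AddMonoid.End A :=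
  (RingHom.fst _ _).comp (Cent β).subtype

/-- The action of the enveloping algebra of the derivations on the first variable. -/
def derAct (β : A →+ B →+ C) : DerEnv β →+* AddMonoid.End A :=
  (RingHom.fst _ _).comp (DerEnv β).subtype

end Bimap

/-! ## Filters -/

/-- An `ℕ`-indexed filter on a group `G`. -/
structure GroupFilter (G : Type*) [Group G] where
  toFun : ℕ → Subgroup G
  zero' : toFun 0 = ⊤
  comm' : ∀ s t, ⁅toFun s, toFun t⁆ ≤ toFun (s + t)
  le' : ∀ s t, toFun (s + t) ≤ toFun s ⊓ toFun t

namespace GroupFilter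

variable {G : Type*} [Group G]

instance : CoeFun (GroupFilter G) (fun _ => ℕ → Subgroup G) := ⟨GroupFilter.toFun⟩

/-- The boundary `φ_s⁺`, generated by the `φ_{s + t}` with `t ≠ 0`. -/
def plus (φ : GroupFilter G) (s : ℕ) : Subgroup G := ⨆ t : {t : ℕ // t ≠ 0}, φ (s + t)

theorem plus_eq (φ : GroupFilter G) (s : ℕ) : φ.plus s = φ (s + 1) := by
  apply le_antisymm
  · refine iSup_le ?_
    rintro ⟨t, ht⟩
    obtain ⟨k, rfl⟩ := Nat.exists_eq_succ_of_ne_zero ht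
    have h := (φ.le' (s + 1) k).trans inf_le_left
    have e : s + 1 + k = s + (k + 1) := by omega
    rwa [e] at h
  · exact le_iSup (fun t : {t : ℕ // t ≠ 0} => φ (s + t)) ⟨1, one_ne_zero⟩

theorem normal (φ : GroupFilter G) (s : ℕ) : (φ s).Normal := by
  rw [← Subgroup.normalizer_eq_top_iff, eq_top_iff, Subgroup.le_normalizer_iff_commutator_le_right]
  have h := φ.comm' 0 s
  rwa [φ.zero', zero_add] at h

theorem plus_normal (φ : GroupFilter G) (s : ℕ) : (φ.plus s).Normal := by
  rw [plus_eq]; exact φ.normal _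

instance (φ : GroupFilter G) (s : ℕ) : ((φ.plus s).subgroupOf (φ s)).Normal :=
  (φ.plus_normal s).subgroupOf _

/-- The factor `φ_s / φ_s⁺`, written multiplicatively. -/
abbrev Factor (φ : GroupFilter G) (s : ℕ) : Type _ := ↥(φ s) ⧸ (φ.plus s).subgroupOf (φ s)

/-- `x⁻¹ y⁻¹ x y` lies in `φ_{s+t}` for `x ∈ φ_s`, `y ∈ φ_t`. -/
theorem comm_mem (φ : GroupFilter G) {s t : ℕ} {x y : G} (hx : x ∈ φ s) (hy : y ∈ φ t) :
    x⁻¹ * y⁻¹ * x * y ∈ φ (s + t) := by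
  have h := φ.comm' s t (Subgroup.commutator_mem_commutator (inv_mem hx) (inv_mem hy))
  simpa [commutatorElement_def] using h

/-- In positive degree the factors are abelian. -/
instance (φ : GroupFilter G) (s : ℕ) [NeZero s] : CommGroup (φ.Factor s) :=
  { (inferInstance : Group (φ.Factor s)) with
    mul_comm := by
      rintro ⟨x⟩ ⟨y⟩
      refine QuotientGroup.eq.2 ?_
      rw [Subgroup.mem_subgroupOf, plus_eq]
      have h := φ.comm_mem y.2 x.2
      have hs : s ≠ 0 := NeZero.ne s
      have e : s + s = s + 1 + (s - 1) := by omega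
      rw [e] at h
      have h' := ((φ.le' (s + 1) (s - 1)).trans inf_le_left) h
      simpa [mul_assoc] using h' }

/-- The homogeneous component `L_s = φ_s / φ_s⁺`, written additively. -/
abbrev L (φ : GroupFilter G) (s : ℕ) : Type _ := Additive (φ.Factor s)

/-- The class of an element of `φ_s` in `L_s`. -/
def toL (φ : GroupFilter G) (s : ℕ) (x : φ s) : φ.L s :=
  Additive.ofMul (QuotientGroup.mk x)

instance neZero_add (s t : ℕ) [NeZero s] : NeZero (s + t) :=
  ⟨by have := NeZero.ne s; omega⟩

theorem toL_eq (φ : GroupFilter G) (s : ℕ) (x y : φ s) :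
    φ.toL s x = φ.toL s y ↔ (x : G)⁻¹ * y ∈ φ (s + 1) := by
  rw [← plus_eq]
  exact (Additive.ofMul.injective.eq_iff).trans
    (QuotientGroup.eq.trans (Subgroup.mem_subgroupOf))

/-- The commutator `[x, y] = x⁻¹ y⁻¹ x y` as an element of `φ_{s+t}`. -/
def commElt (φ : GroupFilter G) (s t : ℕ) (x : φ s) (y : φ t) : φ (s + t) :=
  ⟨(x : G)⁻¹ * (y : G)⁻¹ * x * y, φ.comm_mem x.2 y.2⟩

theorem commElt_mul_left (φ : GroupFilter G) (s t : ℕ) [NeZero s] (x x' : φ s) (y : φ t) :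
    φ.toL (s + t) (φ.commElt s t (x * x') y)
      = φ.toL (s + t) (φ.commElt s t x y) + φ.toL (s + t) (φ.commElt s t x' y) := by
  have hadd : φ.toL (s + t) (φ.commElt s t x y) + φ.toL (s + t) (φ.commElt s t x' y)
      = φ.toL (s + t) (φ.commElt s t x y * φ.commElt s t x' y) := rfl
  rw [hadd, eq_comm, toL_eq]
  have hs : s ≠ 0 := NeZero.ne s
  have h1 := φ.comm_mem (φ.commElt s t x y).2 x'.2
  have e : s + t + s = s + t + 1 + (s - 1) := by omega
  rw [e] at h1
  have h2 := ((φ.le' (s + t + 1) (s - 1)).trans inf_le_left) h1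
  have h3 := (φ.normal (s + t + 1)).conj_mem _ h2 (φ.commElt s t x' y : G)⁻¹
  convert h3 using 1
  simp only [commElt, Subgroup.coe_mul]
  group

theorem commElt_mul_right (φ : GroupFilter G) (s t : ℕ) [NeZero s] [NeZero t]
    (x : φ s) (y y' : φ t) :
    φ.toL (s + t) (φ.commElt s t x (y * y'))
      = φ.toL (s + t) (φ.commElt s t x y) + φ.toL (s + t) (φ.commElt s t x y') := by
  rw [add_comm (φ.toL (s + t) (φ.commElt s t x y))]
  have hadd : φ.toL (s + t) (φ.commElt s t x y') + φ.toL (s + t) (φ.commElt s t x y)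
      = φ.toL (s + t) (φ.commElt s t x y' * φ.commElt s t x y) := rfl
  rw [hadd, eq_comm, toL_eq]
  have ht : t ≠ 0 := NeZero.ne t
  have h1 := φ.comm_mem (φ.commElt s t x y).2 y'.2
  have e : s + t + t = s + t + 1 + (t - 1) := by omega
  rw [e] at h1
  have h2 := ((φ.le' (s + t + 1) (t - 1)).trans inf_le_left) h1
  convert h2 using 1
  simp only [commElt, Subgroup.coe_mul]
  group

/-- Commutation with a fixed `x ∈ φ_s`, as a map `L_t → L_{s+t}`. -/
def commRight (φ : GroupFilter G) (s t : ℕ) [NeZero s] [NeZero t] (x : φ s) :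
    φ.L t →+ φ.L (s + t) :=
  MonoidHom.toAdditive <| QuotientGroup.lift _
    (MonoidHom.mk' (fun y : φ t => (φ.toL (s + t) (φ.commElt s t x y)).toMul)
      (fun y y' => congrArg Additive.toMul (φ.commElt_mul_right s t x y y')))
    (by
      intro y hy
      have hy' : (y : G) ∈ φ (t + 1) := by
        rw [← plus_eq]; exact hy
      refine QuotientGroup.eq.2 ?_ |>.trans (b := QuotientGroup.mk (1 : φ (s + t))) rfl
      rw [Subgroup.mem_subgroupOf, plus_eq]
      have h := φ.comm_mem x.2 hy'
      rw [← add_assoc] at h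
      simpa [commElt, mul_assoc] using inv_mem h)

/-- The commutation bimap `[,] : L_s × L_t → L_{s+t}`. -/
def bimap (φ : GroupFilter G) (s t : ℕ) [NeZero s] [NeZero t] :
    φ.L s →+ φ.L t →+ φ.L (s + t) :=
  AddMonoidHom.toMultiplicativeRight.symm <| QuotientGroup.lift _
    (MonoidHom.mk' (fun x : φ s => Multiplicative.ofAdd (φ.commRight s t x)) (by
      intro x x'
      refine congrArg Multiplicative.ofAdd (AddMonoidHom.ext ?_)
      rintro ⟨y⟩
      exact φ.commElt_mul_left s t x x' y))
    (by
      intro x hx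
      have hx' : (x : G) ∈ φ (s + 1) := by
        rw [← plus_eq]; exact hx
      refine congrArg Multiplicative.ofAdd (AddMonoidHom.ext (g := 0) ?_)
      rintro ⟨y⟩
      refine (toL_eq φ (s + t) (φ.commElt s t x y) 1).2 ?_
      have h := φ.comm_mem hx' y.2
      have e : s + 1 + t = s + t + 1 := by omega
      rw [e] at h
      simpa [commElt, mul_assoc] using inv_mem h)

theorem bimap_toL (φ : GroupFilter G) (s t : ℕ) [NeZero s] [NeZero t] (x : φ s) (y : φ t) :
    φ.bimap s t (φ.toL s x) (φ.toL t y) = φ.toL (s + t) (φ.commElt s t x y) := rfl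

/-! ## Refinements -/

/-- `L_s J^i`: the subgroup generated by all `u a`, `u ∈ L_s`, `a ∈ J^i`, where `J` is the Jacobson
radical of a ring `R` acting on `A`. -/
def radSubgroup {A R : Type*} [AddCommGroup A] [Ring R] (ρ : R →+* AddMonoid.End A) (i : ℕ) :
    AddSubgroup A :=
  AddSubgroup.closure {w | ∃ a ∈ (Ring.jacobson R) ^ i, ∃ u : A, w = ρ a u}

/-- The subgroup `H_i` with `φ_s⁺ ≤ H_i ≤ φ_s` and `H_i / φ_s⁺ = L_s J^i`. -/
def radTerm (φ : GroupFilter G) (s : ℕ) [NeZero s] {R : Type*} [Ring R]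
    (ρ : R →+* AddMonoid.End (φ.L s)) (i : ℕ) : Subgroup G :=
  ((AddSubgroup.toSubgroup' (radSubgroup ρ i)).comap
    (QuotientGroup.mk' ((φ.plus s).subgroupOf (φ s)))).map (φ s).subtype

open Classical in
/-- The function `α` on `ℕ × ℕ`: `α_u^i = φ_u` if `i = 0` or `u ≠ s`, and `α_s^i = H_i`. -/
noncomputable def preRefinement (φ : GroupFilter G) (s : ℕ) [NeZero s] {R : Type*} [Ring R]
    (ρ : R →+* AddMonoid.End (φ.L s)) (p : ℕ × ℕ) : Subgroup G :=
  if p.2 = 0 ∨ p.1 ≠ s then φ p.1 else φ.radTerm s ρ p.2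

/-- For `π : X → {subgroups of G}` with `X ⊆ M`, the function `x ↦ ∏ [π_{x₁}, …, π_{x_d}]` on `M`.
The product runs over the nonempty sequences `x₁, …, x_d` in `X` with `x = x₁ + ⋯ + x_d` (here
`p = (x₁, [x₂, …, x_d])`), and the commutators are left-normed. -/
def generate {M : Type*} [AddCommMonoid M] (X : Set M) (π : M → Subgroup G) (x : M) : Subgroup G :=
  ⨆ p : {p : M × List M // p.1 ∈ X ∧ (∀ y ∈ p.2, y ∈ X) ∧ p.1 + p.2.sum = x},
    p.1.2.foldl (fun H y => ⁅H, π y⁆) (π p.1.1)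

/-- The refinement of `φ` at degree `s` along the radical of a ring acting on `L_s`. It is generated
by the values of `α` on the `(u, i)` lexicographically below `(s + 1, 0)`. -/
noncomputable def refinement (φ : GroupFilter G) (s : ℕ) [NeZero s] {R : Type*} [Ring R]
    (ρ : R →+* AddMonoid.End (φ.L s)) : ℕ × ℕ → Subgroup G :=
  generate {p | toLex p < toLex (s + 1, 0)} (φ.preRefinement s ρ)

/-- `s` is the least positive degree with `L_s ≠ 0`, the degree at which lex-least refinements
are taken. -/
def IsLeastDegree (φ : GroupFilter G) (s : ℕ) : Prop :=
  IsLeast {t : ℕ | t ≠ 0 ∧ φ.plus t ≠ φ t} s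

/-- The adjoint refinement at degree `s`. -/
noncomputable def adjointRefinement (φ : GroupFilter G) (s : ℕ) [NeZero s] :
    ℕ × ℕ → Subgroup G := φ.refinement s (Bimap.adjAct (φ.bimap s s))

/-- The centroid refinement at degree `s`. -/
noncomputable def centroidRefinement (φ : GroupFilter G) (s : ℕ) [NeZero s] :
    ℕ × ℕ → Subgroup G := φ.refinement s (Bimap.centAct (φ.bimap s s))

/-- The derivation refinement at degree `s`. -/
noncomputable def derivationRefinement (φ : GroupFilter G) (s : ℕ) [NeZero s] :
    ℕ × ℕ → Subgroup G := φ.refinement s (Bimap.derAct (φ.bimap s s))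

/-! ## The lower central series as a filter -/

/-- `γ_0 = G` and `γ_i = γ_i(N)`, the `i`-fold commutator of `N`, for `i > 0`. -/
def gammaTerm (N : Subgroup G) : ℕ → Subgroup G
  | 0 => ⊤
  | n + 1 => N.lowerCentralSeries n

theorem commutator_commutator_le (H₁ H₂ H₃ K : Subgroup G) [K.Normal]
    (h1 : ⁅⁅H₂, H₃⁆, H₁⁆ ≤ K) (h2 : ⁅⁅H₃, H₁⁆, H₂⁆ ≤ K) : ⁅⁅H₁, H₂⁆, H₃⁆ ≤ K := by
  have key : ∀ H : Subgroup G, H ≤ K ↔ H.map (QuotientGroup.mk' K) = ⊥ := by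
    intro H
    rw [Subgroup.map_eq_bot_iff, QuotientGroup.ker_mk']
  rw [key] at h1 h2 ⊢
  simp only [Subgroup.map_commutator] at h1 h2 ⊢
  exact Subgroup.commutator_commutator_eq_bot_of_rotate h1 h2

theorem lcs_normal (N : Subgroup G) [N.Normal] (n : ℕ) : (N.lowerCentralSeries n).Normal := by
  induction n with
  | zero => simpa
  | succ d _ => rw [Subgroup.lowerCentralSeries_succ]; infer_instance

theorem commutator_lcs_le (N : Subgroup G) [N.Normal] (m n : ℕ) :
    ⁅N.lowerCentralSeries m, N.lowerCentralSeries n⁆ ≤ N.lowerCentralSeries (m + n + 1) := by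
  induction n generalizing m with
  | zero => exact le_rfl
  | succ n ih =>
    have := lcs_normal N (m + (n + 1) + 1)
    rw [Subgroup.commutator_comm, Subgroup.lowerCentralSeries_succ N n]
    refine commutator_commutator_le _ _ _ _ ?_ ?_
    · rw [Subgroup.commutator_comm N, ← Subgroup.lowerCentralSeries_succ]
      refine (ih (m + 1)).trans (le_of_eq ?_)
      congr 1; omega
    · exact Subgroup.commutator_mono (ih m) le_rfl

/-- The lower central series of a normal subgroup `N` of `G` as a filter on `G`. -/
def gamma (N : Subgroup G) [hN : N.Normal] : GroupFilter G where
  toFun := gammaTerm N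
  zero' := rfl
  comm' := by
    rintro (_ | s) (_ | t)
    · exact le_top
    · have : (gammaTerm N (t + 1)).Normal := lcs_normal N t
      rw [zero_add]; exact Subgroup.commutator_le_right _ _
    · have : (gammaTerm N (s + 1)).Normal := lcs_normal N s
      exact Subgroup.commutator_le_left _ _
    · refine (commutator_lcs_le N s t).trans (le_of_eq ?_)
      change _ = gammaTerm N ((s + 1 + t) + 1)
      change _ = N.lowerCentralSeries (s + 1 + t)
      congr 1; omega
  le' := by
    rintro (_ | s) (_ | t)
    · exact le_inf le_rfl le_rfl
    · rw [zero_add]; exact le_inf le_top le_rfl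
    · exact le_inf le_rfl le_top
    · exact le_inf (N.lowerCentralSeries_antitone (show s ≤ s + 1 + t by omega))
        (N.lowerCentralSeries_antitone (show t ≤ s + 1 + t by omega))

end GroupFilter

/-- The holomorph `Aut(F) ⋉ F`. -/
abbrev Holomorph (F : Type*) [Group F] : Type _ := F ⋊[MonoidHom.id (MulAut F)] MulAut F

instance Holomorph.normal_inl_range (F : Type*) [Group F] :
    (SemidirectProduct.inl : F →* Holomorph F).range.Normal := by
  rw [SemidirectProduct.range_inl_eq_ker_rightHom]
  infer_instance

/-- The `γ` series of `F` as a filter on `F`, with `γ_0 = F`. -/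
def gammaSeries (F : Type*) [Group F] : GroupFilter F := GroupFilter.gamma ⊤

/-- The `γ` series of `F` as a filter on its holomorph: `γ_0 = Aut(F) ⋉ F` and `γ_i = γ_i(F)` for
`i > 0`. -/
def gammaSeriesHol (F : Type*) [Group F] : GroupFilter (Holomorph F) :=
  GroupFilter.gamma (SemidirectProduct.inl : F →* Holomorph F).range

/-! ## The Jacobson radical of a ring acting on an abelian group -/

/-! Everything rests on identifying the commutation bimap with the exterior square of `ℤ^r`
(`nonempty_exteriorSquare`). The difficulty is that γ₂/γ₃ might be too small. Freeness gives a
homomorphism to a class two extension of `ℤ^r` by `Λ²ℤ^r` in which commutators are wedges; its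
second coordinate maps γ₂/γ₃ to `Λ²ℤ^r`, and the universal property of `Λ²` supplies the inverse.

The rings are then studied through their action on `A = ℤ^r`. Comparing 2×2 minors forces centroid
elements to be scalars, and adjoint elements too once a third index is available. For `r = 2` the
wedge is the determinant, and every `X` has the adjoint `tr X - X`. Every endomorphism of `A`
extends to a derivation, so the enveloping ring acts through all of `End A`.

For the radicals, an integral eigenvalue of a radical element is zero
(`Ring.eigenvalue_eq_zero_of_mem_jacobson`). Since the radical is an ideal, multiplying by rank one
operators turns matrix entries into eigenvalues. On `Λ²` such operators arise, up to a factor 2,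
from `D_X² - D_{X²} = 2 Λ²X` with `X` of rank at most two.

With zero radical, `H_i = γ₂` for `i > 0`, so a refinement is built from commutators of terms of the
series. These give terms again (`range_refinement_gamma`): at `(n + 1, m + 1)` the value is
`γ_{n+2}` over `F`, but `γ_{n+1}` over the holomorph, where transvections give `[Aut(F) ⋉ F, F] =
F`. -/

theorem Ring.exists_mul_one_sub_eq_one_of_mem_jacobson {R : Type*} [Ring R] {x : R}
    (hx : x ∈ Ring.jacobson R) : ∃ u, u * (1 - x) = 1 := by
  by_contra h
  have hne : Ideal.span {1 - x} ≠ ⊤ := fun ht =>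
    h (Ideal.mem_span_singleton'.1 ((Ideal.eq_top_iff_one _).1 ht))
  obtain ⟨m, hm, hle⟩ := Ideal.exists_le_maximal _ hne
  refine hm.ne_top ((Ideal.eq_top_iff_one _).2 ?_)
  have h1 : 1 - x ∈ m := hle (Ideal.mem_span_singleton_self _)
  simpa using m.add_mem h1 (Ring.jacobson_le_of_isMaximal m hx)

/-- An element of the Jacobson radical has no nonzero integral eigenvalue on an eigenvector that
takes the value `1` under some additive functional. -/
theorem Ring.eigenvalue_eq_zero_of_mem_jacobson {R M : Type*} [Ring R] [AddCommGroup M]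
    (ρ : R →+* AddMonoid.End M) {y : R} (hy : y ∈ Ring.jacobson R) {v : M} {n : ℤ}
    (hv : ρ y v = n • v) (φ : M →+ ℤ) (hφ : φ v = 1) : n = 0 := by
  -- Left invertibility of `1 - 3y` makes `1 - 3n` a unit of `ℤ`. The factor 3 excludes the unit
  -- `-1`, which `1 - n` and `1 - 2n` attain at `n = 2` and `n = 1`.
  have h3 : (3 : R) * y ∈ Ring.jacobson R := Ideal.mul_mem_left _ _ hy
  obtain ⟨u, hu⟩ := Ring.exists_mul_one_sub_eq_one_of_mem_jacobson h3
  have h3y : ρ (3 * y) v = (3 * n) • v := by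
    rw [map_mul, map_ofNat, AddMonoid.End.coe_mul, Function.comp_apply, hv,
      AddMonoid.End.ofNat_apply, mul_smul]
    exact (natCast_zsmul _ 3).symm
  have h1 : ρ (1 - 3 * y) v = (1 - 3 * n) • v := by
    rw [map_sub, map_one, sub_smul, one_smul, ← h3y]; rfl
  have h2 : ρ u (ρ (1 - 3 * y) v) = v := by
    rw [show ρ u (ρ (1 - 3 * y) v) = (ρ u * ρ (1 - 3 * y)) v from rfl,
      ← map_mul, hu, map_one]; rfl
  rw [h1, map_zsmul] at h2
  have h4 := congrArg φ h2
  rw [map_zsmul, hφ, smul_eq_mul] at h4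
  rcases Int.eq_one_or_neg_one_of_mul_eq_one h4 with h | h <;> omega

/-! ## Bimaps that are exterior squares -/

/-- The alternating map given by an alternating biadditive map. -/
def alternatingOfBimap {V W : Type*} [AddCommGroup V] [AddCommGroup W] (B : V →+ V →+ W)
    (hB : ∀ u, B u u = 0) : V [⋀^Fin 2]→ₗ[ℤ] W where
  toFun m := B (m 0) (m 1)
  map_update_add' m i x y := by
    fin_cases i <;> simp
  map_update_smul' m i c x := by
    fin_cases i <;> simp
  map_eq_zero_of_eq' v i j h hij := by
    fin_cases i <;> fin_cases j <;> simp_all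

theorem AddMonoidHom.skew_of_alternating {V W : Type*} [AddCommGroup V] [AddCommGroup W]
    {B : V →+ V →+ W} (hB : ∀ u, B u u = 0) (u v : V) : B v u = -B u v := by
  have h := hB (u + v)
  simp only [map_add, AddMonoidHom.add_apply, hB, zero_add, add_zero] at h
  exact (neg_eq_of_add_eq_zero_right ((add_comm _ _).trans h)).symm

/-- Diagonal terms vanish, and skew-symmetry folds the terms below the diagonal onto those above it.
-/
theorem AddMonoidHom.alternating_sum_sum {V W : Type*} [AddCommGroup V] [AddCommGroup W]
    {B : V →+ V →+ W} (hB : ∀ u, B u u = 0) {r : ℕ} (x : Fin r → V) (a b : Fin r → ℤ) :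
    B (∑ i, a i • x i) (∑ j, b j • x j) =
      (∑ i, ∑ j, if i < j then (a i * b j) • B (x i) (x j) else 0) -
        ∑ i, ∑ j, if i < j then (b i * a j) • B (x i) (x j) else 0 := by
  have h : B (∑ i, a i • x i) (∑ j, b j • x j) =
      ∑ i, ∑ j, ((if i < j then (a i * b j) • B (x i) (x j) else 0) -
        if j < i then (b j * a i) • B (x j) (x i) else 0) := by
    rw [map_sum B, AddMonoidHom.finsetSum_apply]
    refine Finset.sum_congr rfl fun i _ => ?_
    rw [map_sum]
    refine Finset.sum_congr rfl fun j _ => ?_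
    rw [map_zsmul, map_zsmul, AddMonoidHom.smul_apply, smul_smul]
    rcases lt_trichotomy i j with hij | rfl | hij
    · simp [hij, hij.not_gt, mul_comm]
    · simp [hB]
    · rw [if_neg hij.not_gt, if_pos hij, AddMonoidHom.skew_of_alternating hB (x j) (x i)]
      simp
  rw [h]
  simp only [Finset.sum_sub_distrib]
  congr 1
  exact Finset.sum_comm

/-- An identification of a bimap with the exterior square `ℤ^r × ℤ^r → Λ² ℤ^r`. -/
structure ExteriorSquare {A C : Type*} [AddCommGroup A] [AddCommGroup C] (β : A →+ A →+ C)
    (r : ℕ) where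
  f : A ≃+ (Fin r → ℤ)
  g : C ≃+ ⋀[ℤ]^2 (Fin r → ℤ)
  map_bimap : ∀ u v, g (β u v) = exteriorPower.ιMulti ℤ 2 ![f u, f v]

/-! ### Universal property and coordinates of an exterior square -/

namespace ExteriorSquare

variable {A C : Type*} [AddCommGroup A] [AddCommGroup C] {β : A →+ A →+ C} {r : ℕ}

theorem hom_ext (E : ExteriorSquare β r) {W : Type*} [AddCommGroup W] {h k : C →+ W}
    (hk : ∀ u v, h (β u v) = k (β u v)) : h = k := by
  have key : (h.comp E.g.symm.toAddMonoidHom).toIntLinearMap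
      = (k.comp E.g.symm.toAddMonoidHom).toIntLinearMap := by
    refine exteriorPower.linearMap_ext (AlternatingMap.ext fun m => ?_)
    have hm : E.g (β (E.f.symm (m 0)) (E.f.symm (m 1))) = exteriorPower.ιMulti ℤ 2 m := by
      rw [E.map_bimap]
      congr 1
      ext i : 1
      fin_cases i <;> simp
    have := hk (E.f.symm (m 0)) (E.f.symm (m 1))
    simpa [← hm] using this
  ext c
  simpa using LinearMap.congr_fun key (E.g c)

/-- The universal property of `Λ²`, transported along `f` and `g`. -/
theorem exists_lift (E : ExteriorSquare β r) {W : Type*} [AddCommGroup W] (B : A →+ A →+ W)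
    (hB : ∀ u, B u u = 0) : ∃ h : C →+ W, ∀ u v, h (β u v) = B u v := by
  let B' := (alternatingOfBimap B hB).compLinearMap E.f.symm.toAddMonoidHom.toIntLinearMap
  refine ⟨(exteriorPower.alternatingMapLinearEquiv B').toAddMonoidHom.comp E.g.toAddMonoidHom,
    fun u v => ?_⟩
  have : exteriorPower.alternatingMapLinearEquiv B' (E.g (β u v)) = B u v := by
    rw [E.map_bimap, exteriorPower.alternatingMapLinearEquiv_apply_ιMulti]
    simp [B', alternatingOfBimap]
  exact this

theorem alternating (E : ExteriorSquare β r) (u : A) : β u u = 0 := by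
  apply E.g.injective
  rw [E.map_bimap, map_zero]
  exact AlternatingMap.map_eq_zero_of_eq _ _ (i := 0) (j := 1) rfl (by decide)

theorem exists_minor (E : ExteriorSquare β r) (a b : Fin r) :
    ∃ h : C →+ ℤ, ∀ u v, h (β u v) = E.f u a * E.f v b - E.f u b * E.f v a := by
  let p (i : Fin r) : A →+ ℤ := (Pi.evalAddMonoidHom _ i).comp E.f.toAddMonoidHom
  let B (i j : Fin r) : A →+ A →+ ℤ := (AddMonoidHom.mul.comp (p i)).compl₂ (p j)
  obtain ⟨h, hh⟩ := E.exists_lift (B a b - B b a) (fun u => by simp [B, p]; ring)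
  exact ⟨h, fun u v => by rw [hh]; simp [B, p]⟩

/-- The functional `u ∧ v ↦ u_a v_b - u_b v_a`. -/
noncomputable def minor (E : ExteriorSquare β r) (a b : Fin r) : C →+ ℤ :=
  (E.exists_minor a b).choose

theorem minor_apply (E : ExteriorSquare β r) (a b : Fin r) (u v : A) :
    E.minor a b (β u v) = E.f u a * E.f v b - E.f u b * E.f v a :=
  (E.exists_minor a b).choose_spec u v

/-- The basis of `A` corresponding to the standard basis of `ℤ^r`. -/
def e (E : ExteriorSquare β r) (i : Fin r) : A := E.f.symm (Pi.single i 1)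

@[simp] theorem f_e (E : ExteriorSquare β r) (i j : Fin r) :
    E.f (E.e i) j = if j = i then 1 else 0 := by
  simp [e, Pi.single_apply]

theorem sum_e (E : ExteriorSquare β r) (u : A) : ∑ i, E.f u i • E.e i = u := by
  apply E.f.injective
  ext j
  simp [map_sum]

theorem hom_ext_e (E : ExteriorSquare β r) {W : Type*} [AddCommGroup W] {h k : A →+ W}
    (hk : ∀ i, h (E.e i) = k (E.e i)) : h = k := by
  ext u
  rw [← E.sum_e u]
  simp [map_sum, hk]

/-- The minors are the coordinates on `C` dual to the `e_i ∧ e_j` with `i < j`. Both sides are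
additive in `w`, so it suffices to compare them on wedges. -/
theorem sum_minor (E : ExteriorSquare β r) (w : C) :
    ∑ i, ∑ j, (if i < j then E.minor i j w • β (E.e i) (E.e j) else 0) = w := by
  let S : C →+ C := ∑ i, ∑ j, if i < j then
    ((zmultiplesHom C (β (E.e i) (E.e j))).comp (E.minor i j)) else 0
  have hS : ∀ w, S w = ∑ i, ∑ j, (if i < j then E.minor i j w • β (E.e i) (E.e j) else 0) := by
    intro w
    simp only [S, AddMonoidHom.finsetSum_apply]
    refine Finset.sum_congr rfl fun i _ => Finset.sum_congr rfl fun j _ => ?_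
    split_ifs <;> simp
  have : S = AddMonoidHom.id C := by
    refine E.hom_ext fun u v => ?_
    rw [hS, AddMonoidHom.id_apply]
    conv_rhs => rw [← E.sum_e u, ← E.sum_e v, AddMonoidHom.alternating_sum_sum E.alternating]
    simp only [E.minor_apply, ← Finset.sum_sub_distrib]
    refine Finset.sum_congr rfl fun i _ => Finset.sum_congr rfl fun j _ => ?_
    split_ifs
    · rw [← sub_smul, mul_comm (E.f v i)]
    · rw [sub_zero]
  rw [← hS, this]; rfl

theorem eq_zero_of_minor (E : ExteriorSquare β r) {w : C} (h : ∀ i j, i < j → E.minor i j w = 0) :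
    w = 0 := by
  rw [← E.sum_minor w]
  refine Finset.sum_eq_zero fun i _ => Finset.sum_eq_zero fun j _ => ?_
  split_ifs with hij
  · rw [h i j hij, zero_smul]
  · rfl

end ExteriorSquare

/-! ### Endomorphisms acting on an exterior square -/

namespace ExteriorSquare

variable {A C : Type*} [AddCommGroup A] [AddCommGroup C] {β : A →+ A →+ C} {r : ℕ}

theorem end_ext (E : ExteriorSquare β r) {h k : AddMonoid.End C}
    (hk : ∀ u v, h (β u v) = k (β u v)) : h = k :=
  E.hom_ext hk

theorem end_ext_e (E : ExteriorSquare β r) {h k : AddMonoid.End A}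
    (hk : ∀ i, h (E.e i) = k (E.e i)) : h = k :=
  E.hom_ext_e hk

theorem exists_ne_fin (hr : 2 ≤ r) (i : Fin r) : ∃ j, i ≠ j := by
  have : Nontrivial (Fin r) := Fin.nontrivial_iff_two_le.2 hr
  obtain ⟨j, hj⟩ := exists_ne i
  exact ⟨j, hj.symm⟩

/-- For `i ≠ j`, the `(i, j)` minor of `e_i ∧ w` is the coordinate `w_j`. -/
theorem eq_zero_of_forall_left (E : ExteriorSquare β r) (hr : 2 ≤ r) {w : A}
    (h : ∀ u, β u w = 0) : w = 0 := by
  apply E.f.injective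
  ext j
  obtain ⟨i, hi⟩ := exists_ne_fin hr j
  have := congrArg (E.minor i j) (h (E.e i))
  rw [E.minor_apply] at this
  simpa [hi] using this

theorem scalar_of_diagonal (E : ExteriorSquare β r) {X : A →+ A} {n : ℤ}
    (h : ∀ i j, E.f (X (E.e i)) j = if j = i then n else 0) (u : A) : X u = n • u := by
  have : X = n • AddMonoidHom.id A := by
    refine E.hom_ext_e fun i => E.f.injective ?_
    ext j
    rw [h, AddMonoidHom.smul_apply, map_zsmul, AddMonoidHom.id_apply, Pi.smul_apply, E.f_e]
    simp
  rw [this]; rfl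

/-- An endomorphism `X` with `X u ∧ u = 0` for all `u` is a scalar. -/
theorem exists_scalar (E : ExteriorSquare β r) (hr : 2 ≤ r) {X : A →+ A}
    (hX : ∀ u, β (X u) u = 0) : ∃ n : ℤ, ∀ u, X u = n • u := by
  have off : ∀ i k, k ≠ i → E.f (X (E.e i)) k = 0 := fun i k hk => by
    have := congrArg (E.minor k i) (hX (E.e i))
    rw [E.minor_apply] at this
    simpa [hk] using this
  -- Polarization: the hypothesis at `e_i + e_j` compares the two diagonal entries, the off-diagonal
  -- ones being zero.
  have diag : ∀ i j, E.f (X (E.e i)) i = E.f (X (E.e j)) j := fun i j => by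
    rcases eq_or_ne i j with rfl | hij
    · rfl
    have := congrArg (E.minor i j) (hX (E.e i + E.e j))
    rw [E.minor_apply] at this
    simpa [hij, hij.symm, off i j hij.symm, off j i hij, sub_eq_zero] using this
  refine ⟨E.f (X (E.e ⟨0, by omega⟩)) ⟨0, by omega⟩, E.scalar_of_diagonal fun i j => ?_⟩
  split_ifs with h
  · subst h; exact diag _ _
  · exact off i j h

/-- The map `(u, v) ↦ Xu ∧ v + u ∧ Xv` is alternating, hence factors through `C`. -/
theorem exists_derivation (E : ExteriorSquare β r) (X : A →+ A) :
    ∃ D : C →+ C, ∀ u v, D (β u v) = β (X u) v + β u (X v) := by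
  obtain ⟨D, hD⟩ := E.exists_lift (β.comp X + β.compl₂ X) fun u => by
    simp [AddMonoidHom.skew_of_alternating E.alternating u (X u)]
  exact ⟨D, hD⟩

/-- The endomorphism `u ↦ u_a c + u_b d`. -/
noncomputable def rankTwo (E : ExteriorSquare β r) (a b : Fin r) (c d : A) : A →+ A :=
  ((zmultiplesHom A c).comp ((Pi.evalAddMonoidHom _ a).comp E.f.toAddMonoidHom)) +
    (zmultiplesHom A d).comp ((Pi.evalAddMonoidHom _ b).comp E.f.toAddMonoidHom)

theorem rankTwo_apply (E : ExteriorSquare β r) (a b : Fin r) (c d u : A) :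
    E.rankTwo a b c d u = E.f u a • c + E.f u b • d := by
  simp [rankTwo]

/-- Thus `Λ²` of this endomorphism is `w ↦ minor_ab(w) (c ∧ d)`, a substitute for matrix units on
`C`. -/
theorem bimap_rankTwo (E : ExteriorSquare β r) (a b : Fin r) (c d u v : A) :
    β (E.rankTwo a b c d u) (E.rankTwo a b c d v) = E.minor a b (β u v) • β c d := by
  simp only [E.rankTwo_apply, E.minor_apply, map_add, AddMonoidHom.add_apply, map_zsmul,
    AddMonoidHom.smul_apply, E.alternating, AddMonoidHom.skew_of_alternating E.alternating c d]
  module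

/-! ### Rings acting by scalars or by all endomorphisms -/

section Rings

variable {R : Type*} [Ring R]

theorem nonempty_ringEquiv_int (E : ExteriorSquare β r) (hr : 2 ≤ r) {ρ : R →+* AddMonoid.End A}
    (hρ : Function.Injective ρ) (hs : ∀ x, ∃ n : ℤ, ∀ u, ρ x u = n • u) :
    Nonempty (R ≃+* ℤ) := by
  have hcast : ∀ (n : ℤ) u, ρ n u = n • u := fun n u => by
    rw [map_intCast, AddMonoid.End.intCast_apply]
  refine ⟨(RingEquiv.ofBijective (Int.castRingHom R) ⟨fun m n h => ?_, fun x => ?_⟩).symm⟩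
  · have h1 : ρ m (E.e ⟨0, by omega⟩) = ρ n (E.e ⟨0, by omega⟩) :=
      congrArg (fun x => ρ x (E.e ⟨0, by omega⟩)) h
    rw [hcast, hcast] at h1
    simpa using congrArg (fun u => E.f u ⟨0, by omega⟩) h1
  · obtain ⟨n, hn⟩ := hs x
    exact ⟨n, hρ (DFunLike.ext _ _ fun u => (hcast n u).trans (hn u).symm)⟩

theorem jacobson_eq_bot_of_scalar (E : ExteriorSquare β r) (hr : 2 ≤ r)
    {ρ : R →+* AddMonoid.End A}
    (hρ : Function.Injective ρ) (hs : ∀ x, ∃ n : ℤ, ∀ u, ρ x u = n • u) :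
    Ring.jacobson R = ⊥ := by
  refine (Submodule.eq_bot_iff _).2 fun x hx => ?_
  obtain ⟨n, hn⟩ := hs x
  have : n = 0 := Ring.eigenvalue_eq_zero_of_mem_jacobson ρ hx (hn (E.e ⟨0, by omega⟩))
    ((Pi.evalAddMonoidHom _ ⟨0, by omega⟩).comp E.f.toAddMonoidHom) (by simp)
  refine hρ (DFunLike.ext _ _ fun u => ?_)
  rw [hn, this, zero_smul, map_zero]; rfl

/-- If `a` acts as `u ↦ u_j e_i`, then `a x` has eigenvector `e_i`, and its eigenvalue is the `j`-th
coordinate of `x e_i`. It lies in the radical, so this coordinate vanishes. -/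
theorem map_jacobson_eq_zero (E : ExteriorSquare β r)
    {ρ : R →+* AddMonoid.End A} (hρ : Function.Surjective ρ) {x : R}
    (hx : x ∈ Ring.jacobson R) : ρ x = 0 := by
  refine E.end_ext_e fun i => E.f.injective (funext fun j => ?_)
  obtain ⟨a, ha⟩ := hρ (E.rankTwo j j (E.e i) 0)
  have h1 : ρ (a * x) (E.e i) = E.f (ρ x (E.e i)) j • E.e i := by
    rw [map_mul, ha]
    exact (E.rankTwo_apply _ _ _ _ _).trans (by rw [smul_zero, add_zero]; rfl)
  have := Ring.eigenvalue_eq_zero_of_mem_jacobson ρ (Ideal.mul_mem_left _ a hx) h1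
    ((Pi.evalAddMonoidHom _ i).comp E.f.toAddMonoidHom) (by simp)
  rw [this]
  exact (congrFun (map_zero E.f) j).symm

end Rings

open Bimap

/-! ### The centroid -/

theorem centAct_scalar (E : ExteriorSquare β r) (hr : 2 ≤ r) (p : Cent β) :
    ∃ n : ℤ, ∀ u, centAct β p u = n • u :=
  E.exists_scalar hr fun u => (p.2 u u).1.trans (by rw [E.alternating, map_zero])

/-- `X` determines `Z` because wedges generate `C`, and `Z` determines `Y` by nondegeneracy. -/
theorem centAct_injective (E : ExteriorSquare β r) (hr : 2 ≤ r) :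
    Function.Injective (centAct β) := by
  refine (injective_iff_map_eq_zero _).2 fun p hp => ?_
  have hX : ∀ u, p.1.1 u = 0 := fun u => DFunLike.congr_fun hp u
  have hZ : p.1.2.2 = 0 := E.end_ext fun u v => by
    rw [← (p.2 u v).1, hX, map_zero]; rfl
  have hY : p.1.2.1 = 0 := DFunLike.ext _ _ fun v => E.eq_zero_of_forall_left hr fun u => by
    rw [(p.2 u v).2, hZ]; rfl
  exact Subtype.ext (Prod.ext hp (Prod.ext hY hZ))

/-! ### The adjoint ring -/

theorem adjAct_injective (E : ExteriorSquare β r) (hr : 2 ≤ r) :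
    Function.Injective (adjAct β) := by
  refine (injective_iff_map_eq_zero _).2 fun p hp => ?_
  have hX : ∀ u, p.1.1 u = 0 := fun u => DFunLike.congr_fun hp u
  refine Subtype.ext (Prod.ext hp (MulOpposite.unop_injective (DFunLike.ext _ _ fun v =>
    E.eq_zero_of_forall_left hr fun u => ?_)))
  rw [← p.2 u v, hX, map_zero]; rfl

/-- In `X e_i ∧ e_j = e_i ∧ Y e_j` take the `(k, j)` minor. For `j` distinct from `i ≠ k` it gives
`X_ki = 0`; for `k = i ≠ j` it gives `X_ii = Y_jj`. Any two diagonal entries of `X` are then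
compared through a third index `j`. -/
theorem adjAct_scalar (E : ExteriorSquare β r) (hr : 3 ≤ r) (p : Adj β) :
    ∃ n : ℤ, ∀ u, adjAct β p u = n • u := by
  let X : A →+ A := p.1.1
  let Y : A →+ A := p.1.2.unop
  have hXY : ∀ k i j, E.minor k j (β (X (E.e i)) (E.e j)) = E.minor k j (β (E.e i) (Y (E.e j))) :=
    fun k i j => congrArg _ (p.2 _ _)
  have third : ∀ i k : Fin r, ∃ j, j ≠ i ∧ j ≠ k := fun i k => by
    obtain ⟨j, hj⟩ := Finset.exists_mem_notMem_of_card_lt_card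
      (s := {i, k}) (t := (Finset.univ : Finset (Fin r)))
      (Finset.card_le_two.trans_lt (by rw [Finset.card_univ, Fintype.card_fin]; exact hr))
    exact ⟨j, by simpa using hj⟩
  have off : ∀ i k, k ≠ i → E.f (X (E.e i)) k = 0 := fun i k hk => by
    obtain ⟨j, hji, hjk⟩ := third i k
    have := hXY k i j
    rw [E.minor_apply, E.minor_apply] at this
    simpa [hk, hji, hjk.symm] using this
  have dd : ∀ i j, i ≠ j → E.f (X (E.e i)) i = E.f (Y (E.e j)) j := fun i j hij => by
    have := hXY i i j
    rw [E.minor_apply, E.minor_apply] at this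
    simpa [hij, hij.symm] using this
  refine ⟨E.f (X (E.e ⟨0, by omega⟩)) ⟨0, by omega⟩, E.scalar_of_diagonal fun i j => ?_⟩
  split_ifs with h
  · subst h
    obtain ⟨k, hk, hk'⟩ := third j ⟨0, by omega⟩
    exact (dd _ _ hk.symm).trans (dd _ _ hk'.symm).symm
  · exact off i j h

/-- In rank two the bimap is the determinant form, and `det(Xu, v) + det(u, Xv) = tr(X) det(u, v)`
makes the adjugate `tr X - X` an adjoint of `X`. -/
theorem adjAct_surjective (E : ExteriorSquare β 2) : Function.Surjective (adjAct β) := by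
  intro X
  let X' : A →+ A := X
  let t : ℤ := E.f (X (E.e 0)) 0 + E.f (X (E.e 1)) 1
  have key : β.comp X' = β.compl₂ (t • AddMonoidHom.id A - X') := by
    refine E.hom_ext_e fun i => E.hom_ext_e fun j => ?_
    rw [← sub_eq_zero]
    refine E.eq_zero_of_minor fun a b hab => ?_
    obtain ⟨rfl, rfl⟩ : a = 0 ∧ b = 1 := by omega
    have h1 : ∀ u v, β.comp X' u v = β (X' u) v := fun _ _ => rfl
    have h2 : ∀ v, (t • AddMonoidHom.id A - X') v = t • v - X' v := fun _ => rfl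
    have h3 : t = E.f (X' (E.e 0)) 0 + E.f (X' (E.e 1)) 1 := rfl
    rw [map_sub, h1, AddMonoidHom.compl₂_apply, h2, E.minor_apply, E.minor_apply, h3]
    fin_cases i <;> fin_cases j <;> simp
  exact ⟨⟨(X, MulOpposite.op (t • AddMonoidHom.id A - X')),
    fun u v => DFunLike.congr_fun (DFunLike.congr_fun key u) v⟩, rfl⟩

theorem nonempty_adj_ringEquiv_matrix (E : ExteriorSquare β 2) :
    Nonempty (Adj β ≃+* Matrix (Fin 2) (Fin 2) ℤ) :=
  ⟨(RingEquiv.ofBijective (adjAct β) ⟨E.adjAct_injective le_rfl, E.adjAct_surjective⟩).trans <|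
    (addMonoidEndRingEquivInt A).trans <| E.f.toIntLinearEquiv.conjRingEquiv.trans
      LinearMap.toMatrixAlgEquiv'.toRingEquiv⟩

theorem jacobson_adj (E : ExteriorSquare β r) (hr : 2 ≤ r) : Ring.jacobson (Adj β) = ⊥ := by
  rcases hr.eq_or_lt with rfl | hr'
  · exact (Submodule.eq_bot_iff _).2 fun x hx => E.adjAct_injective le_rfl <| by
      rw [E.map_jacobson_eq_zero E.adjAct_surjective hx, map_zero]
  · exact E.jacobson_eq_bot_of_scalar hr (E.adjAct_injective hr) (E.adjAct_scalar hr')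

/-! ### The enveloping ring of the derivations -/

theorem exists_mem_derEnv (E : ExteriorSquare β r) (X : A →+ A) :
    ∃ D : C →+ C, (∀ u v, D (β u v) = β (X u) v + β u (X v)) ∧
      ((X, X, D) : AddMonoid.End A × AddMonoid.End A × AddMonoid.End C) ∈ DerEnv β := by
  obtain ⟨D, hD⟩ := E.exists_derivation X
  exact ⟨D, hD, Subring.subset_closure fun u v => (hD u v).symm⟩

theorem derAct_surjective (E : ExteriorSquare β r) : Function.Surjective (derAct β) := fun X => by
  obtain ⟨D, -, hD⟩ := E.exists_mem_derEnv X
  exact ⟨⟨_, hD⟩, rfl⟩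

/-- Both projections to `End A` are onto, which kills the first two coordinates of a radical
element. The image in `End C` need not be everything, but it contains twice enough rank one
operators to detect every entry of the third coordinate. -/
theorem jacobson_derEnv (E : ExteriorSquare β r) : Ring.jacobson (DerEnv β) = ⊥ := by
  refine (Submodule.eq_bot_iff _).2 fun x hx => ?_
  have h1 : x.1.1 = 0 := E.map_jacobson_eq_zero E.derAct_surjective hx
  have h2 : x.1.2.1 = 0 := by
    refine E.map_jacobson_eq_zero (ρ := ((RingHom.fst _ _).comp (RingHom.snd _ _)).comp
      (DerEnv β).subtype) (fun X => ?_) hx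
    obtain ⟨D, -, hD⟩ := E.exists_mem_derEnv X
    exact ⟨⟨_, hD⟩, rfl⟩
  let ρ : DerEnv β →+* AddMonoid.End C :=
    ((RingHom.snd _ _).comp (RingHom.snd _ _)).comp (DerEnv β).subtype
  have h4 : ∀ c d, c < d → ∀ i j, E.minor i j (ρ x (β (E.e c) (E.e d))) = 0 := by
    intro c d hcd i j
    set X := E.rankTwo i j (E.e c) (E.e d) with hX
    obtain ⟨D, hD, hDm⟩ := E.exists_mem_derEnv X
    obtain ⟨D', hD', hDm'⟩ := E.exists_mem_derEnv (X.comp X)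
    -- `D_X²` sends `u ∧ v` to `X²u ∧ v + 2 Xu ∧ Xv + u ∧ X²v`; subtracting `D_{X²}` leaves `2 Λ²X`.
    let T : DerEnv β := ⟨_, hDm⟩ * ⟨_, hDm⟩ - ⟨_, hDm'⟩
    have hT : ρ T = (2 : ℤ) • (zmultiplesHom C (β (E.e c) (E.e d))).comp (E.minor i j) := by
      refine E.end_ext fun u v => ?_
      have : ρ T (β u v) = D (D (β u v)) - D' (β u v) := rfl
      have hm : (2 : ℤ) • β (X u) (X v) = ((2 : ℤ) • (zmultiplesHom C (β (E.e c) (E.e d))).comp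
          (E.minor i j)) (β u v) := by rw [hX, E.bimap_rankTwo]; rfl
      rw [this, hD, hD', map_add, hD, hD]
      refine Eq.trans ?_ hm
      simp only [AddMonoidHom.comp_apply]
      abel
    have hv : ρ (T * x) (β (E.e c) (E.e d)) =
        (2 * E.minor i j (ρ x (β (E.e c) (E.e d)))) • β (E.e c) (E.e d) := by
      rw [map_mul, hT, mul_smul]; rfl
    have := Ring.eigenvalue_eq_zero_of_mem_jacobson ρ (Ideal.mul_mem_left _ T hx) hv
      (E.minor c d) (by rw [E.minor_apply]; simp [hcd.ne])
    omega
  have h3 : ρ x = 0 := DFunLike.ext _ _ fun w => by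
    rw [← E.sum_minor w, map_sum]
    refine Finset.sum_eq_zero fun c _ => ?_
    rw [map_sum]
    refine Finset.sum_eq_zero fun d _ => ?_
    split_ifs with hcd
    · rw [map_zsmul, E.eq_zero_of_minor fun i j _ => h4 c d hcd i j, smul_zero]
    · exact map_zero _
  exact Subtype.ext (Prod.ext h1 (Prod.ext h2 h3))

end ExteriorSquare

open scoped commutatorElement

namespace GroupFilter

variable {G : Type*} [Group G]

/-! ## Refinements along a trivial radical -/

theorem antitone (φ : GroupFilter G) : Antitone φ := fun s t h => by
  obtain ⟨k, rfl⟩ := Nat.exists_eq_add_of_le h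
  exact (φ.le' s k).trans inf_le_left

theorem radSubgroup_eq_bot {A R : Type*} [AddCommGroup A] [Ring R] (ρ : R →+* AddMonoid.End A)
    (hJ : Ring.jacobson R = ⊥) {i : ℕ} (hi : i ≠ 0) : radSubgroup ρ i = ⊥ := by
  refine (AddSubgroup.closure_eq_bot_iff).2 ?_
  rintro w ⟨a, ha, u, rfl⟩
  rw [hJ, Submodule.bot_pow hi] at ha
  rw [(Submodule.mem_bot R).1 ha, map_zero]
  rfl

theorem radTerm_eq (φ : GroupFilter G) (s : ℕ) [NeZero s] {R : Type*} [Ring R]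
    (ρ : R →+* AddMonoid.End (φ.L s)) (hJ : Ring.jacobson R = ⊥) {i : ℕ} (hi : i ≠ 0) :
    φ.radTerm s ρ i = φ (s + 1) := by
  have hle : φ.plus s ≤ φ s := by
    rw [plus_eq]; exact φ.antitone (Nat.le_succ s)
  have h : AddSubgroup.toSubgroup' (⊥ : AddSubgroup (φ.L s)) = ⊥ := map_bot _
  rw [radTerm, radSubgroup_eq_bot ρ hJ hi, h, MonoidHom.comap_bot, QuotientGroup.ker_mk',
    Subgroup.subgroupOf_map_subtype, inf_eq_left.2 hle, plus_eq]

/-- Induction along the sequence: each commutator adds filter degrees, and subadditivity of `w` with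
antitonicity of `φ` absorbs the difference. -/
theorem generate_le {M : Type*} [AddCommMonoid M] (φ : GroupFilter G) {X : Set M}
    {π : M → Subgroup G} {w : M → ℕ} (hw : ∀ x y, w (x + y) ≤ w x + w y)
    (hπ : ∀ x ∈ X, π x ≤ φ (w x)) (x : M) : generate X π x ≤ φ (w x) := by
  refine iSup_le ?_
  rintro ⟨⟨a, l⟩, ha, hl, rfl⟩
  have key : ∀ (l : List M) (H : Subgroup G) (a : M), H ≤ φ (w a) → (∀ y ∈ l, y ∈ X) →
      l.foldl (fun H y => ⁅H, π y⁆) H ≤ φ (w (a + l.sum)) := by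
    intro l
    induction l with
    | nil => intro H a h _; simpa using h
    | cons y l ih =>
      intro H a h hl
      rw [List.forall_mem_cons] at hl
      rw [List.foldl_cons, List.sum_cons, ← add_assoc]
      exact ih _ _ ((Subgroup.commutator_mono h (hπ y hl.1)).trans
        ((φ.comm' _ _).trans (φ.antitone (hw a y)))) hl.2
  exact key l _ a (hπ a ha) hl

theorem le_generate {M : Type*} [AddCommMonoid M] {X : Set M} (π : M → Subgroup G) {a x : M}
    {l : List M} (ha : a ∈ X) (hl : ∀ y ∈ l, y ∈ X) (hx : a + l.sum = x) :
    l.foldl (fun H y => ⁅H, π y⁆) (π a) ≤ generate X π x :=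
  le_iSup (fun p : {p : M × List M // p.1 ∈ X ∧ (∀ y ∈ p.2, y ∈ X) ∧ p.1 + p.2.sum = x} =>
    p.1.2.foldl (fun H y => ⁅H, π y⁆) (π p.1.1)) ⟨(a, l), ha, hl, hx⟩

theorem foldl_replicate {M : Type*} {π : M → Subgroup G} {N : Subgroup G} {y : M} (hy : π y = N)
    (k n : ℕ) : (List.replicate n y).foldl (fun H y => ⁅H, π y⁆) (N.lowerCentralSeries k)
      = N.lowerCentralSeries (k + n) := by
  induction n generalizing k with
  | zero => rfl
  | succ n ih =>
    rw [List.replicate_succ, List.foldl_cons, hy, ← Subgroup.lowerCentralSeries_succ, ih]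
    congr 1; omega

/-- A refinement of the lower central series in degree one along a trivial radical adds no new
terms, if `N` is everything or satisfies `[G, N] = N`. -/
theorem range_refinement_gamma (N : Subgroup G) [N.Normal] (hN : N = ⊤ ∨ ⁅(⊤ : Subgroup G), N⁆ = N)
    {R : Type*} [Ring R] (ρ : R →+* AddMonoid.End ((gamma N).L 1)) (hJ : Ring.jacobson R = ⊥) :
    Set.range ((gamma N).refinement 1 ρ) = Set.range (gamma N) := by
  set π := (gamma N).preRefinement 1 ρ
  have h0 : ∀ i, π (0, i) = ⊤ := fun i => if_pos (Or.inr zero_ne_one)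
  have h10 : π (1, 0) = N := if_pos (Or.inl rfl)
  have h1 : ∀ i, π (1, i + 1) = N.lowerCentralSeries 1 := fun i => by
    refine (if_neg ?_).trans (radTerm_eq _ _ ρ hJ (Nat.succ_ne_zero i))
    simp
  have hX : ∀ p : ℕ × ℕ, p ∈ {p : ℕ × ℕ | toLex p < toLex (1 + 1, 0)} ↔ p.1 = 0 ∨ p.1 = 1 := by
    intro p
    rw [Set.mem_ofPred_eq, Prod.Lex.toLex_lt_toLex]
    simp
    omega
  have hrep : ∀ n, ∀ y ∈ List.replicate n ((1, 0) : ℕ × ℕ),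
      y ∈ {p : ℕ × ℕ | toLex p < toLex (1 + 1, 0)} := fun n y hy => by
    rw [List.eq_of_mem_replicate hy, hX]; exact Or.inr rfl
  have hsum : ∀ n, (List.replicate n ((1, 0) : ℕ × ℕ)).sum = (n, 0) := fun n => by
    simp [List.sum_replicate]
  have upper : ∀ x, (gamma N).refinement 1 ρ x ≤ gamma N x.1 := by
    refine generate_le (gamma N) (w := Prod.fst) (fun _ _ => le_rfl) ?_
    rintro ⟨u, i⟩ hp
    rcases (hX _).1 hp with rfl | rfl
    · exact le_top
    · cases i with
      | zero => exact h10.le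
      | succ i => exact (h1 i).le.trans ((gamma N).antitone (show 1 ≤ 2 by omega))
  have v0 : ∀ m, (gamma N).refinement 1 ρ (0, m) = ⊤ := fun m =>
    top_unique <| (h0 m).ge.trans <|
      le_generate π (l := []) ((hX _).2 (Or.inl rfl)) (by simp) (by simp)
  have v1 : ∀ n, (gamma N).refinement 1 ρ (n + 1, 0) = gamma N (n + 1) := fun n => by
    refine (upper _).antisymm ?_
    refine le_trans (le_of_eq ?_) (le_generate π (a := (1, 0)) (l := List.replicate n (1, 0))
      ((hX _).2 (Or.inr rfl)) (hrep n) (by rw [hsum]; simp [add_comm]))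
    have := foldl_replicate h10 0 n
    rw [h10]
    refine Eq.trans ?_ this.symm
    rw [zero_add]; rfl
  have v2 : ∀ n m, (gamma N).refinement 1 ρ (n + 1, m + 1) ∈ Set.range (gamma N) := fun n m => by
    rcases hN with hN | hN
    · refine ⟨n + 2, le_antisymm ?_ ?_⟩
      · refine le_trans (le_of_eq ?_) (le_generate π (a := (1, m + 1))
          (l := List.replicate n (1, 0)) ((hX _).2 (Or.inr rfl)) (hrep n)
          (by rw [hsum]; simp [add_comm]))
        rw [h1, foldl_replicate h10, add_comm 1 n]; rfl
      · have := generate_le (gamma N) (X := {p : ℕ × ℕ | toLex p < toLex (1 + 1, 0)}) (π := π)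
          (w := fun p => p.1 + min 1 p.2) (fun x y => by simp only [Prod.fst_add, Prod.snd_add]; omega)
          (by
            rintro ⟨u, i⟩ hp
            rcases (hX _).1 hp with h | h <;> simp only at h <;> subst h
            · cases i with
              | zero => exact le_top
              | succ i =>
                have : 0 + min 1 (i + 1) = 1 := by omega
                simp only [this]
                exact le_top.trans hN.ge
            · cases i with
              | zero => exact h10.le
              | succ i =>
                have : 1 + min 1 (i + 1) = 2 := by omega
                simp only [this]
                exact (h1 i).le) (n + 1, m + 1)
        exact this.trans (le_of_eq (congrArg _ (by simp)))
    · refine ⟨n + 1, le_antisymm ?_ (upper _)⟩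
      -- The index `(0, m + 1)` carries the second coordinate at no cost: its value is `⊤`, and `[⊤,
      -- N] = N`.
      refine le_trans (le_of_eq ?_) (le_generate π (a := (0, m + 1))
        (l := List.replicate (n + 1) (1, 0)) ((hX _).2 (Or.inl rfl)) (hrep _)
        (by rw [hsum]; simp))
      rw [h0, List.replicate_succ, List.foldl_cons, h10, hN]
      refine Eq.trans ?_ (foldl_replicate h10 0 n).symm
      rw [zero_add]; rfl
  apply Set.Subset.antisymm
  · rintro _ ⟨⟨_ | n, m⟩, rfl⟩
    · exact ⟨0, (v0 m).symm⟩
    · cases m with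
      | zero => exact ⟨n + 1, (v1 n).symm⟩
      | succ m => exact v2 n m
  · rintro _ ⟨_ | n, rfl⟩
    · exact ⟨(0, 0), v0 0⟩
    · exact ⟨(n + 1, 0), v1 n⟩

end GroupFilter

/-! ## Free groups -/

namespace FreeGroupBasis

variable {ι F : Type*} [Group F]

theorem closure_range (b : FreeGroupBasis ι F) : Subgroup.closure (Set.range b) = ⊤ := by
  have h : (MonoidHom.id F) = (Subgroup.closure (Set.range b)).subtype.comp
      (b.lift fun i => ⟨b i, Subgroup.subset_closure ⟨i, rfl⟩⟩) := b.ext_hom _ _ fun i => by simp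
  refine top_unique fun x _ => ?_
  have hx : x = ((b.lift fun i => ⟨b i, Subgroup.subset_closure ⟨i, rfl⟩⟩ :
    F →* Subgroup.closure (Set.range b)) x : F) := DFunLike.congr_fun h x
  rw [hx]
  exact Subtype.property _

/-- Conjugation by the only basis element fixes the basis, so that element is central; then every
conjugation fixes the basis. -/
theorem mul_comm_of_subsingleton [Subsingleton ι] (b : FreeGroupBasis ι F) (x y : F) :
    x * y = y * x := by
  have h1 : ∀ i y, b i * y = y * b i := fun i y => by
    have : (MulAut.conj (b i)).toMonoidHom = MonoidHom.id F := b.ext_hom _ _ fun j => by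
      simp [Subsingleton.elim i j]
    exact mul_inv_eq_iff_eq_mul.1 (DFunLike.congr_fun this y)
  have : (MulAut.conj x).toMonoidHom = MonoidHom.id F := b.ext_hom _ _ fun j => by
    simp [← h1 j x]
  exact mul_inv_eq_iff_eq_mul.1 (DFunLike.congr_fun this y)

/-- The automorphism multiplying the `j`-th basis element by the `i`-th one. -/
theorem exists_transvection (b : FreeGroupBasis ι F) {i j : ι} (hij : i ≠ j) :
    ∃ α : MulAut F, α (b j) = b i * b j := by
  classical
  refine ⟨MonoidHom.toMulEquiv (b.lift (Function.update b j (b i * b j)))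
    (b.lift (Function.update b j ((b i)⁻¹ * b j))) ?_ ?_, ?_⟩
  · refine b.ext_hom _ _ fun k => ?_
    rcases eq_or_ne k j with rfl | hk
    · simp [hij]
    · simp [hk]
  · refine b.ext_hom _ _ fun k => ?_
    rcases eq_or_ne k j with rfl | hk
    · simp [hij]
    · simp [hk]
  · simp

/-- For the transvection `α` with `α(b_j) = b_i b_j`, the commutator of `α` and `b_j` is `α(b_j)
b_j⁻¹ = b_i`. -/
theorem commutator_top_range_inl [Nontrivial ι] (b : FreeGroupBasis ι F) :
    ⁅(⊤ : Subgroup (Holomorph F)), (SemidirectProduct.inl : F →* Holomorph F).range⁆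
      = (SemidirectProduct.inl : F →* Holomorph F).range := by
  refine le_antisymm (Subgroup.commutator_le_right _ _) ?_
  rw [MonoidHom.range_eq_map, Subgroup.map_le_iff_le_comap, ← b.closure_range,
    Subgroup.closure_le]
  rintro _ ⟨i, rfl⟩
  obtain ⟨j, hj⟩ := exists_ne i
  obtain ⟨α, hα⟩ := b.exists_transvection hj.symm
  have h : (SemidirectProduct.inl (b i) : Holomorph F) =
      ⁅(SemidirectProduct.inr α : Holomorph F), SemidirectProduct.inl (b j)⁆ := by
    have := SemidirectProduct.inl_aut (φ := MonoidHom.id (MulAut F)) α (b j)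
    rw [commutatorElement_def, ← map_inv SemidirectProduct.inr, ← this, ← map_inv, ← map_mul]
    simp [hα]
  rw [SetLike.mem_coe, Subgroup.mem_comap, b.closure_range, ← MonoidHom.range_eq_map, h]
  exact Subgroup.commutator_mem_commutator trivial ⟨b j, rfl⟩

end FreeGroupBasis

/-! ## Central extensions by a bilinear cocycle -/

/-- The group on `A × C` with multiplication `(a, x) (b, y) = (a + b, x + y + c a b)`. -/
@[ext]
structure BilinearExtension {A C : Type*} [AddCommGroup A] [AddCommGroup C] (c : A →+ A →+ C) where
  fst : A
  snd : C

namespace BilinearExtension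

variable {A C : Type*} [AddCommGroup A] [AddCommGroup C] {c : A →+ A →+ C}

instance : Mul (BilinearExtension c) := ⟨fun p q => ⟨p.fst + q.fst, p.snd + q.snd + c p.fst q.fst⟩⟩
instance : One (BilinearExtension c) := ⟨⟨0, 0⟩⟩
instance : Inv (BilinearExtension c) := ⟨fun p => ⟨-p.fst, -p.snd + c p.fst p.fst⟩⟩

@[simp] theorem fst_mul (p q : BilinearExtension c) : (p * q).fst = p.fst + q.fst := rfl
@[simp] theorem snd_mul (p q : BilinearExtension c) :
    (p * q).snd = p.snd + q.snd + c p.fst q.fst := rfl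
@[simp] theorem fst_one : (1 : BilinearExtension c).fst = 0 := rfl
@[simp] theorem snd_one : (1 : BilinearExtension c).snd = 0 := rfl
@[simp] theorem fst_inv (p : BilinearExtension c) : (p⁻¹).fst = -p.fst := rfl
@[simp] theorem snd_inv (p : BilinearExtension c) : (p⁻¹).snd = -p.snd + c p.fst p.fst := rfl

instance : Group (BilinearExtension c) :=
  Group.ofLeftAxioms
    (fun p q s => by ext <;> simp <;> abel)
    (fun p => by ext <;> simp)
    (fun p => by ext <;> simp)

/-- The projection to `A`. -/
def proj : BilinearExtension c →* Multiplicative A where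
  toFun p := Multiplicative.ofAdd p.fst
  map_one' := rfl
  map_mul' _ _ := rfl

theorem snd_commutator (p q : BilinearExtension c) :
    (p⁻¹ * q⁻¹ * p * q).snd = c p.fst q.fst - c q.fst p.fst := by
  simp
  abel

end BilinearExtension

/-- The biadditive map `(u, v) ↦ u ∧ v`. -/
noncomputable def wedge (r : ℕ) : (Fin r → ℤ) →+ (Fin r → ℤ) →+ ⋀[ℤ]^2 (Fin r → ℤ) :=
  AddMonoidHom.mk' (fun u => AddMonoidHom.mk' (fun v => exteriorPower.ιMulti ℤ 2 ![u, v])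
    (fun v v' => by
      have h : ∀ v, Function.update ![u, 0] 1 v = ![u, v] := fun v => by
        ext i : 1; fin_cases i <;> rfl
      have := (exteriorPower.ιMulti ℤ 2).map_update_add ![u, 0] 1 v v'
      rwa [h, h, h] at this))
    (fun u u' => AddMonoidHom.ext fun v => by
      have h : ∀ u, Function.update ![0, v] 0 u = ![u, v] := fun u => by
        ext i : 1; fin_cases i <;> rfl
      have := (exteriorPower.ιMulti ℤ 2).map_update_add ![0, v] 0 u u'
      rwa [h, h, h] at this)

theorem wedge_apply (r : ℕ) (u v : Fin r → ℤ) :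
    wedge r u v = exteriorPower.ιMulti ℤ 2 ![u, v] := rfl

theorem wedge_self (r : ℕ) (u : Fin r → ℤ) : wedge r u u = 0 :=
  (exteriorPower.ιMulti ℤ 2 (M := Fin r → ℤ)).map_eq_zero_of_eq ![u, u] (i := 0) (j := 1) rfl (by decide)

/-- The part of the exterior product above the diagonal. -/
noncomputable def upperWedge (r : ℕ) : (Fin r → ℤ) →+ (Fin r → ℤ) →+ ⋀[ℤ]^2 (Fin r → ℤ) :=
  let s (u v : Fin r → ℤ) := ∑ i, ∑ j,
    if i < j then (u i * v j) • wedge r (Pi.single i 1) (Pi.single j 1) else 0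
  have h1 (u v v') : s u (v + v') = s u v + s u v' := by
    simp only [s, ← Finset.sum_add_distrib]
    refine Finset.sum_congr rfl fun i _ => Finset.sum_congr rfl fun j _ => ?_
    split_ifs
    · rw [Pi.add_apply, mul_add, add_smul]
    · rw [add_zero]
  have h2 (u u' v) : s (u + u') v = s u v + s u' v := by
    simp only [s, ← Finset.sum_add_distrib]
    refine Finset.sum_congr rfl fun i _ => Finset.sum_congr rfl fun j _ => ?_
    split_ifs
    · rw [Pi.add_apply, add_mul, add_smul]
    · rw [add_zero]
  AddMonoidHom.mk' (fun u => AddMonoidHom.mk' (s u) (h1 u)) fun u u' => AddMonoidHom.ext (h2 u u')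

/-- This is why the cocycle is half of the wedge: with the full wedge as cocycle, commutators would
be `2 (u ∧ v)`, and the map to `Λ²` would miss odd elements. -/
theorem upperWedge_sub (r : ℕ) (u v : Fin r → ℤ) :
    upperWedge r u v - upperWedge r v u = wedge r u v := by
  have hs : ∀ u : Fin r → ℤ, ∑ i, u i • (Pi.single i 1 : Fin r → ℤ) = u := fun u => by
    ext j; simp [Finset.sum_apply, Pi.single_apply]
  conv_rhs => rw [← hs u, ← hs v, AddMonoidHom.alternating_sum_sum (wedge_self r)]
  rfl

/-! ### The commutation bimap of a free group in degree one -/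

namespace GroupFilter

variable {G : Type*} [Group G] {N : Subgroup G} [N.Normal] {r : ℕ}

/-- The class of an element as a homomorphism. -/
def toLHom (φ : GroupFilter G) (s : ℕ) [NeZero s] : φ s →* Multiplicative (φ.L s) where
  toFun x := Multiplicative.ofAdd (φ.toL s x)
  map_one' := rfl
  map_mul' _ _ := rfl

theorem toL_surjective (φ : GroupFilter G) (s : ℕ) : Function.Surjective (φ.toL s) := fun u => by
  obtain ⟨x, hx⟩ := QuotientGroup.mk_surjective (Additive.toMul u)
  exact ⟨x, congrArg Additive.ofMul hx⟩

theorem bimap_self (φ : GroupFilter G) (s : ℕ) [NeZero s] (u : φ.L s) : φ.bimap s s u u = 0 := by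
  obtain ⟨x, rfl⟩ := φ.toL_surjective s u
  rw [bimap_toL]
  have : φ.commElt s s x x = 1 := Subtype.ext (by simp [commElt])
  rw [this]; rfl

/-- A homomorphism on `φ_s` trivial on `φ_{s+1}` descends to `L_s`. -/
def liftL (φ : GroupFilter G) (s : ℕ) [NeZero s] {W : Type*} [AddCommGroup W]
    (h : φ s →* Multiplicative W) (hh : ∀ x : φ s, (x : G) ∈ φ (s + 1) → h x = 1) : φ.L s →+ W :=
  MonoidHom.toAdditiveLeft (QuotientGroup.lift _ h fun x hx => hh x (by
    rw [← plus_eq]; exact hx))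

/-- The homomorphism to the free class two nilpotent group, as an extension of `ℤ^r` by its exterior
square. -/
noncomputable def toExtension (b : FreeGroupBasis (Fin r) N) :
    N →* BilinearExtension (upperWedge r) :=
  b.lift fun i => ⟨Pi.single i 1, 0⟩

theorem toExtension_fst_eq_zero (b : FreeGroupBasis (Fin r) N) (x : N) (hx : (x : G) ∈ gamma N 2) :
    (toExtension b x).fst = 0 := by
  have h : gamma N 2 ≤ (BilinearExtension.proj.comp (toExtension b)).ker.map N.subtype := by
    refine Subgroup.commutator_le.2 fun p hp q hq => ?_
    refine ⟨⁅(⟨p, hp⟩ : N), (⟨q, hq⟩ : N)⁆, ?_, rfl⟩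
    rw [SetLike.mem_coe, MonoidHom.mem_ker, map_commutatorElement, commutatorElement_eq_one_iff_mul_comm]
    exact mul_comm _ _
  obtain ⟨y, hy, hyx⟩ := h hx
  rw [← Subtype.ext hyx]
  exact hy

/-- Elements of γ₂ map to first coordinate zero, and such elements are central in the extension. -/
theorem toExtension_eq_one (b : FreeGroupBasis (Fin r) N) (x : N) (hx : (x : G) ∈ gamma N 3) :
    toExtension b x = 1 := by
  have h : gamma N 3 ≤ (toExtension b).ker.map N.subtype := by
    refine Subgroup.commutator_le.2 fun p hp q hq => ?_
    have hpN : p ∈ N := (gamma N).antitone (show 1 ≤ 2 by omega) hp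
    refine ⟨⁅(⟨p, hpN⟩ : N), (⟨q, hq⟩ : N)⁆, ?_, rfl⟩
    rw [SetLike.mem_coe, MonoidHom.mem_ker, map_commutatorElement, commutatorElement_eq_one_iff_mul_comm]
    have h0 := toExtension_fst_eq_zero b ⟨p, hpN⟩ hp
    ext1
    · simp [h0]
    · simp [h0, add_comm]
  obtain ⟨y, hy, hyx⟩ := h hx
  rw [← Subtype.ext hyx]
  exact hy

/-- The commutation bimap of a free group in degree one is an exterior square. -/
theorem nonempty_exteriorSquare (b : FreeGroupBasis (Fin r) N) :
    Nonempty (ExteriorSquare ((gamma N).bimap 1 1) r) := by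
  let θ := toExtension b
  have hle : gamma N (1 + 1) ≤ gamma N 1 := (gamma N).antitone (show 1 ≤ 2 by omega)
  let f : (gamma N).L 1 →+ (Fin r → ℤ) := (gamma N).liftL 1 (BilinearExtension.proj.comp θ)
    (fun x hx => toExtension_fst_eq_zero b x hx)
  have hf : ∀ x : N, f ((gamma N).toL 1 x) = (θ x).fst := fun x => rfl
  let k : (Fin r → ℤ) →+ (gamma N).L 1 :=
    ∑ i, (zmultiplesHom _ ((gamma N).toL 1 (b i))).comp (Pi.evalAddMonoidHom _ i)
  have hk : ∀ i, k (Pi.single i 1) = (gamma N).toL 1 (b i) := fun i => by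
    simp only [k, AddMonoidHom.finsetSum_apply]
    rw [Finset.sum_eq_single i]
    · simp
    · intro j _ hj; simp [hj]
    · simp
  have hθ : ∀ i, θ (b i) = ⟨Pi.single i 1, 0⟩ := fun i => by simp [θ, toExtension]
  -- Two homomorphisms on a free group that agree on a basis are equal.
  have hkf : ∀ u, k (f u) = u := fun u => by
    obtain ⟨x, rfl⟩ := (gamma N).toL_surjective 1 u
    have : (AddMonoidHom.toMultiplicative (k.comp f)).comp ((gamma N).toLHom 1)
        = (gamma N).toLHom 1 := b.ext_hom _ _ fun i => congrArg Multiplicative.ofAdd <| by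
      change k (f ((gamma N).toL 1 (b i))) = (gamma N).toL 1 (b i)
      rw [hf, hθ, hk]
    exact congrArg Multiplicative.toAdd (DFunLike.congr_fun this x)
  have hfk : ∀ a, f (k a) = a := fun a => by
    have : f.comp k = AddMonoidHom.id _ := by
      refine AddMonoidHom.functions_ext' _ _ _ fun i => AddMonoidHom.ext_int ?_
      change f (k (Pi.single i 1)) = Pi.single i 1
      rw [hk, hf, hθ]
    exact DFunLike.congr_fun this a
  let f' : (gamma N).L 1 ≃+ (Fin r → ℤ) :=
    { f with invFun := k, left_inv := hkf, right_inv := hfk }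
  let g : (gamma N).L (1 + 1) →+ ⋀[ℤ]^2 (Fin r → ℤ) := (gamma N).liftL (1 + 1)
    { toFun := fun x => Multiplicative.ofAdd (θ ⟨x, hle x.2⟩).snd
      map_one' := congrArg (fun p => Multiplicative.ofAdd p.snd) (map_one θ)
      map_mul' := fun x y => congrArg Multiplicative.ofAdd <| by
        have h : θ ⟨x * y, hle (x * y).2⟩ = θ ⟨x, hle x.2⟩ * θ ⟨y, hle y.2⟩ :=
          map_mul θ (⟨x, hle x.2⟩ : N) ⟨y, hle y.2⟩
        -- The cocycle term vanishes on γ₂, so the second coordinate is multiplicative there.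
        have h0 : (θ ⟨x, hle x.2⟩).fst = 0 := toExtension_fst_eq_zero b _ x.2
        refine (congrArg BilinearExtension.snd h).trans ?_
        rw [BilinearExtension.snd_mul, h0, map_zero, AddMonoidHom.zero_apply, add_zero]
        rfl }
    (fun x hx => congrArg (fun p => Multiplicative.ofAdd p.snd) (toExtension_eq_one b ⟨x, hle x.2⟩ hx))
  have hg : ∀ u v, g ((gamma N).bimap 1 1 u v) = exteriorPower.ιMulti ℤ 2 ![f u, f v] := by
    intro u v
    obtain ⟨x, rfl⟩ := (gamma N).toL_surjective 1 u
    obtain ⟨y, rfl⟩ := (gamma N).toL_surjective 1 v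
    rw [bimap_toL, ← wedge_apply, ← upperWedge_sub]
    refine Eq.trans ?_ (BilinearExtension.snd_commutator (θ x) (θ y))
    have : ∀ x y : N, θ (x⁻¹ * y⁻¹ * x * y) = (θ x)⁻¹ * (θ y)⁻¹ * θ x * θ y := fun x y => by
      simp only [map_mul, map_inv]
    exact congrArg BilinearExtension.snd (this x y)
  let h := exteriorPower.alternatingMapLinearEquiv
    ((alternatingOfBimap ((gamma N).bimap 1 1) ((gamma N).bimap_self 1)).compLinearMap
      k.toIntLinearMap)
  have hh : ∀ m, h (exteriorPower.ιMulti ℤ 2 m) = (gamma N).bimap 1 1 (k (m 0)) (k (m 1)) :=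
    fun m => exteriorPower.alternatingMapLinearEquiv_apply_ιMulti _ _
  have hgh : ∀ w, g (h w) = w := fun w => by
    have : g.toIntLinearMap ∘ₗ h = LinearMap.id := by
      refine exteriorPower.linearMap_ext (AlternatingMap.ext fun m => ?_)
      change g (h (exteriorPower.ιMulti ℤ 2 m)) = exteriorPower.ιMulti ℤ 2 m
      rw [hh, hg, hfk, hfk]
      congr 1
      ext i : 1
      fin_cases i <;> rfl
    exact DFunLike.congr_fun this w
  have hhg : ∀ u, h (g u) = u := fun u => by
    obtain ⟨x, rfl⟩ := (gamma N).toL_surjective (1 + 1) u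
    -- The locus where `h ∘ g` fixes the class is a subgroup, so it is enough that it contains the
    -- commutators generating γ₂.
    let K : Subgroup (gamma N (1 + 1)) := MonoidHom.eqLocus
      ((AddMonoidHom.toMultiplicative (h.toAddMonoidHom.comp g)).comp ((gamma N).toLHom (1 + 1)))
      ((gamma N).toLHom (1 + 1))
    have hK : gamma N (1 + 1) ≤ K.map (gamma N (1 + 1)).subtype := by
      refine Subgroup.commutator_le.2 fun p hp q hq => ?_
      -- The inverses convert `p q p⁻¹ q⁻¹` into the convention `x⁻¹ y⁻¹ x y`.
      refine ⟨(gamma N).commElt 1 1 ⟨p⁻¹, inv_mem hp⟩ ⟨q⁻¹, inv_mem hq⟩, ?_, ?_⟩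
      · refine congrArg Multiplicative.ofAdd ?_
        change h (g ((gamma N).toL (1 + 1) _)) = (gamma N).toL (1 + 1) _
        rw [← bimap_toL, hg, hh]
        simp [hkf]
      · simp [commElt, commutatorElement_def]
    obtain ⟨y, hy, hyx⟩ := hK x.2
    rw [← Subtype.ext hyx]
    exact congrArg Multiplicative.toAdd hy
  exact ⟨f', { g with invFun := h, left_inv := hhg, right_inv := hgh }, hg⟩

theorem isLeastDegree_one {φ : GroupFilter G} (E : ExteriorSquare (φ.bimap 1 1) r) (hr : 2 ≤ r) :
    φ.IsLeastDegree 1 := by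
  refine ⟨⟨one_ne_zero, fun h => ?_⟩, fun t ht => Nat.one_le_iff_ne_zero.2 ht.1⟩
  have h0 : ∀ u : φ.L 1, u = 0 := fun u => by
    obtain ⟨x, rfl⟩ := φ.toL_surjective 1 u
    refine (φ.toL_eq 1 x 1).2 ?_
    rw [← plus_eq, h]
    exact mul_mem (inv_mem x.2) (one_mem _)
  have := congrArg (fun u => E.f u ⟨0, by omega⟩) (h0 (E.e ⟨0, by omega⟩))
  simp at this

/-- The lower central series of a free group of rank at least two has no proper refinement in degree
one along the radicals of its commutation bimap. -/
theorem range_refinements (b : FreeGroupBasis (Fin r) N) (hr : 2 ≤ r)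
    (hN : N = ⊤ ∨ ⁅(⊤ : Subgroup G), N⁆ = N) :
    (gamma N).IsLeastDegree 1 ∧
    Set.range ((gamma N).adjointRefinement 1) = Set.range (gamma N) ∧
    Set.range ((gamma N).centroidRefinement 1) = Set.range (gamma N) ∧
    Set.range ((gamma N).derivationRefinement 1) = Set.range (gamma N) := by
  obtain ⟨E⟩ := nonempty_exteriorSquare b
  exact ⟨isLeastDegree_one E hr, range_refinement_gamma N hN _ (E.jacobson_adj hr),
    range_refinement_gamma N hN _
      (E.jacobson_eq_bot_of_scalar hr (E.centAct_injective hr) (E.centAct_scalar hr)),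
    range_refinement_gamma N hN _ E.jacobson_derEnv⟩

end GroupFilter

theorem mainTheorem9 {F : Type*} [Group F] {r : ℕ} (b : FreeGroupBasis (Fin r) F)
    (hF : ∃ x y : F, x * y ≠ y * x) :
    -- the commutation bimap is the exterior square
    (∃ (f : (gammaSeries F).L 1 ≃+ (Fin r → ℤ)) (g : (gammaSeries F).L (1 + 1) ≃+ ⋀[ℤ]^2 (Fin r → ℤ)),
      ∀ u v, g ((gammaSeries F).bimap 1 1 u v) = exteriorPower.ιMulti ℤ 2 ![f u, f v]) ∧
    -- the adjoint ring and the centroid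
    (r ≠ 2 → Nonempty (Bimap.Adj ((gammaSeries F).bimap 1 1) ≃+* ℤ)) ∧
    (r = 2 → Nonempty (Bimap.Adj ((gammaSeries F).bimap 1 1) ≃+* Matrix (Fin 2) (Fin 2) ℤ)) ∧
    Nonempty (Bimap.Cent ((gammaSeries F).bimap 1 1) ≃+* ℤ) ∧
    -- the three radicals vanish
    Ring.jacobson (Bimap.Adj ((gammaSeries F).bimap 1 1)) = ⊥ ∧
    Ring.jacobson (Bimap.Cent ((gammaSeries F).bimap 1 1)) = ⊥ ∧
    Ring.jacobson (Bimap.DerEnv ((gammaSeries F).bimap 1 1)) = ⊥ ∧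
    -- no lex-least refinement is proper, when the zeroth term of the series is the free group
    (gammaSeries F).IsLeastDegree 1 ∧
    Set.range ((gammaSeries F).adjointRefinement 1) = Set.range (gammaSeries F) ∧
    Set.range ((gammaSeries F).centroidRefinement 1) = Set.range (gammaSeries F) ∧
    Set.range ((gammaSeries F).derivationRefinement 1) = Set.range (gammaSeries F) ∧
    -- nor when the zeroth term of the series is the holomorph
    (gammaSeriesHol F).IsLeastDegree 1 ∧
    Set.range ((gammaSeriesHol F).adjointRefinement 1) = Set.range (gammaSeriesHol F) ∧
    Set.range ((gammaSeriesHol F).centroidRefinement 1) = Set.range (gammaSeriesHol F) ∧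
    Set.range ((gammaSeriesHol F).derivationRefinement 1) = Set.range (gammaSeriesHol F) := by
  have hr : 2 ≤ r := by
    by_contra h
    have : Subsingleton (Fin r) := Fin.subsingleton_iff_le_one.2 (by omega)
    obtain ⟨x, y, hxy⟩ := hF
    exact hxy (b.mul_comm_of_subsingleton x y)
  have : Nontrivial (Fin r) := Fin.nontrivial_iff_two_le.2 hr
  obtain ⟨E⟩ : Nonempty (ExteriorSquare ((gammaSeries F).bimap 1 1) r) :=
    GroupFilter.nonempty_exteriorSquare (b.map Subgroup.topEquiv.symm)
  refine ⟨⟨E.f, E.g, E.map_bimap⟩,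
    fun h => E.nonempty_ringEquiv_int hr (E.adjAct_injective hr) (E.adjAct_scalar (by omega)),
    fun h => ?_, E.nonempty_ringEquiv_int hr (E.centAct_injective hr) (E.centAct_scalar hr),
    E.jacobson_adj hr,
    E.jacobson_eq_bot_of_scalar hr (E.centAct_injective hr) (E.centAct_scalar hr),
    E.jacobson_derEnv, ?_⟩
  · subst h
    exact E.nonempty_adj_ringEquiv_matrix
  · obtain ⟨h1, h2, h3, h4⟩ := GroupFilter.range_refinements
      (b.map Subgroup.topEquiv.symm) hr (Or.inl rfl)
    -- The same argument applies with `N` the copy of `F` in its holomorph: only the ambient group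
    -- changes.
    have hol := GroupFilter.range_refinements
      (b.map (MonoidHom.ofInjective (f := (SemidirectProduct.inl : F →* Holomorph F))
        SemidirectProduct.inl_injective)) hr (Or.inr b.commutator_top_range_inl)
    exact ⟨h1, h2, h3, h4, hol⟩
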